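/- **Theorem.** Let $(X,\mathcal C)$ be a uniformly locally finite coarse space. If $X$ has property A, then its uniform Roe (translation) C\*-algebra $C^*_u(X)$ is nuclear. Here a coarse structure $\mathcal C$ on a set $X$ is a family of subsets of $X\times X$ (the controlled sets) that contains the diagonal $\Delta_X$ and is closed under inverses, compositions $T_1\circ T_2=\{(x,y):\exists z,\ (x,z)\in T_1,\ (z,y)\in T_2\}$, finite unions and subsets. It is uniformly locally finite if $\sup_{x\in X}\#\{u\in X:(u,x)\in T\}<\infty$ for every $T\in\mathcal C$. The space has property A if for every $\epsilon>0$ and every $T\in\mathcal C$ there exist $S\in\mathcal C$ and $A\subset S\times\mathbb N$ such that, with $A_x=\{(y,n):(x,y,n)\in A\}$: every $A_x$ is finite; $(x,x,1)\in A$ for every $x\in X$; and $\#(A_x\triangle A_y)<\epsilon\,\#(A_x\cap A_y)$ whenever $(x,y)\in T$. The algebra $C^*_u(X)$ is the operator norm closure in $\mathbb B(\ell^2(X))$ of $\bigcup_{T\in\mathcal C}E_T$, where $E_T=\{a\in\mathbb B(\ell^2(X)):\langle a\delta_y,\delta_x\rangle=0\text{ for all }(x,y)\notin T\}$. A C\*-algebra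 $B$ is nuclear if for every finite $F\subset B$ and every $\epsilon>0$ there are $n\in\mathbb N$ and contractive completely positive maps $\varphi:B\to M_n(\mathbb C)$ and $\psi:M_n(\mathbb C)\to B$ with $\|\psi(\varphi(b))-b\|<\epsilon$ for all $b\in F$. -/

import Mathlib

open scoped ENNReal InnerProductSpace ComplexOrder

/-- A coarse structure on a set `X`: a family of subsets of `X × X` (the controlled sets, or
entourages) which contains the diagonal and is closed under inverses, composition, finite unions
and passing to subsets. Here `(x, y) ∈ T.inv ↔ (y, x) ∈ T` and
`(x, y) ∈ T₁.comp T₂ ↔ ∃ z, (x, z) ∈ T₁ ∧ (z, y) ∈ T₂`. -/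
structure CoarseStructure (X : Type*) where
  /-- The family of controlled sets. -/
  controlled : Set (SetRel X X)
  id_mem : SetRel.id ∈ controlled
  inv_mem : ∀ T ∈ controlled, T.inv ∈ controlled
  comp_mem : ∀ T₁ ∈ controlled, ∀ T₂ ∈ controlled, T₁.comp T₂ ∈ controlled
  union_mem : ∀ T₁ ∈ controlled, ∀ T₂ ∈ controlled, T₁ ∪ T₂ ∈ controlled
  subset_mem : ∀ T₁ ∈ controlled, ∀ T₂ ⊆ T₁, T₂ ∈ controlled

namespace CoarseStructure

variable {X : Type*}

/-- The fibre `T[x] = {u | (u, x) ∈ T}`. -/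
def fiber (T : SetRel X X) (x : X) : Set X := {u | (u, x) ∈ T}

/-- Uniform local finiteness: `sup_x #T[x] < ∞` for every controlled set `T`. -/
def UniformlyLocallyFinite (C : CoarseStructure X) : Prop :=
  ∀ T ∈ C.controlled, (⨆ x : X, (fiber T x).encard) < ⊤

/-- The slice `A_x = {(y, n) | (x, y, n) ∈ A}` of a set `A ⊆ X × X × ℕ`. -/
def slice (A : Set ((X × X) × ℕ)) (x : X) : Set (X × ℕ) := {p | ((x, p.1), p.2) ∈ A}

/-- Property A of a (uniformly locally finite) coarse space. -/
def PropertyA (C : CoarseStructure X) : Prop :=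
  ∀ ε : ℝ, 0 < ε → ∀ T ∈ C.controlled,
    ∃ S ∈ C.controlled, ∃ A : Set ((X × X) × ℕ), A ⊆ S ×ˢ Set.univ ∧
      (∀ x, (slice A x).Finite) ∧
      (∀ x, ((x, x), 1) ∈ A) ∧
      (∀ x y, (x, y) ∈ T →
        ((symmDiff (slice A x) (slice A y)).ncard : ℝ) <
          ε * ((slice A x ∩ slice A y).ncard : ℝ))

end CoarseStructure

/-- The Hilbert space `ℓ²(X)`. -/
noncomputable abbrev EllTwo (X : Type*) := lp (fun _ : X => ℂ) 2

namespace EllTwo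

variable {X : Type*}

/-- The standard basis vector `δ_x` of `ℓ²(X)`. -/
noncomputable def delta (x : X) : EllTwo X :=
  open Classical in lp.single 2 x (1 : ℂ)

/-- The matrix coefficient `⟨b δ_y, δ_x⟩`. In Mathlib the inner product is linear in the second
variable, so this is `⟪δ_x, b δ_y⟫`. -/
noncomputable def coeff (b : EllTwo X →L[ℂ] EllTwo X) (x y : X) : ℂ :=
  ⟪delta x, b (delta y)⟫_ℂ

theorem inner_delta_left (x : X) (f : EllTwo X) : ⟪delta x, f⟫_ℂ = f x := by
  classical
  simp [delta, lp.inner_single_left]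

theorem coeff_star (b : EllTwo X →L[ℂ] EllTwo X) (x y : X) :
    coeff (star b) x y = star (coeff b y x) := by
  simp [coeff, ContinuousLinearMap.star_eq_adjoint, ContinuousLinearMap.adjoint_inner_right]

theorem coeff_mul (a b : EllTwo X →L[ℂ] EllTwo X) (x y : X) :
    coeff (a * b) x y = ∑' z, coeff a x z * coeff b z y := by
  have h : coeff (a * b) x y = ⟪star a (delta x), b (delta y)⟫_ℂ := by
    simp [coeff, ContinuousLinearMap.star_eq_adjoint, ContinuousLinearMap.adjoint_inner_left]
  rw [h, lp.inner_eq_tsum]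
  refine tsum_congr fun z => ?_
  have h1 : (star a (delta x)) z = star (coeff a x z) := by
    rw [← inner_delta_left, ← coeff_star]; rfl
  have h2 : (b (delta y)) z = coeff b z y := by
    rw [← inner_delta_left]; rfl
  rw [h1, h2]
  simp [mul_comm]

end EllTwo

/-- The space `E_T` of bounded operators on `ℓ²(X)` whose matrix coefficients vanish outside the
set `T`. -/
def bandSpace {X : Type*} (T : SetRel X X) : Set (EllTwo X →L[ℂ] EllTwo X) :=
  {a | ∀ x y, (x, y) ∉ T → EllTwo.coeff a x y = 0}

namespace CoarseStructure

variable {X : Type*}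

/-- The union of the spaces `E_T` over all controlled sets `T`, as a unital `*`-subalgebra of
`B(ℓ²(X))`. -/
noncomputable def bandAlgebra (C : CoarseStructure X) : StarSubalgebra ℂ (EllTwo X →L[ℂ] EllTwo X) where
  carrier := ⋃ T ∈ C.controlled, bandSpace T
  mul_mem' := by
    intro a b ha hb
    simp only [Set.mem_iUnion, exists_prop] at ha hb ⊢
    obtain ⟨T₁, h₁, ha⟩ := ha
    obtain ⟨T₂, h₂, hb⟩ := hb
    refine ⟨T₁.comp T₂, C.comp_mem _ h₁ _ h₂, fun x y hxy => ?_⟩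
    rw [EllTwo.coeff_mul]
    have h0 : ∀ z, EllTwo.coeff a x z * EllTwo.coeff b z y = 0 := by
      intro z
      by_cases h : (x, z) ∈ T₁
      · rw [hb z y fun h' => hxy ⟨z, h, h'⟩, mul_zero]
      · rw [ha x z h, zero_mul]
    simp [h0]
  add_mem' := by
    intro a b ha hb
    simp only [Set.mem_iUnion, exists_prop] at ha hb ⊢
    obtain ⟨T₁, h₁, ha⟩ := ha
    obtain ⟨T₂, h₂, hb⟩ := hb
    refine ⟨T₁ ∪ T₂, C.union_mem _ h₁ _ h₂, fun x y hxy => ?_⟩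
    have e₁ := ha x y fun h => hxy (Or.inl h)
    have e₂ := hb x y fun h => hxy (Or.inr h)
    simp only [EllTwo.coeff] at e₁ e₂ ⊢
    rw [add_apply, inner_add_right, e₁, e₂, add_zero]
  algebraMap_mem' := by
    intro r
    simp only [Set.mem_iUnion, exists_prop]
    refine ⟨SetRel.id, C.id_mem, fun x y hxy => ?_⟩
    have hne : x ≠ y := fun h => hxy h
    have h0 : ⟪EllTwo.delta x, EllTwo.delta y⟫_ℂ = 0 := by
      classical
      rw [EllTwo.inner_delta_left]
      simp [EllTwo.delta, lp.single_apply, hne]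
    simp [EllTwo.coeff, Algebra.algebraMap_eq_smul_one, h0]
  star_mem' := by
    intro a ha
    simp only [Set.mem_iUnion, exists_prop] at ha ⊢
    obtain ⟨T, h, ha⟩ := ha
    refine ⟨T.inv, C.inv_mem _ h, fun x y hxy => ?_⟩
    rw [EllTwo.coeff_star, ha y x hxy, star_zero]

/-- The uniform Roe algebra (translation C*-algebra) `C*_u(X)`: the norm closure in `B(ℓ²(X))` of
the union of the spaces `E_T`, `T` controlled. -/
noncomputable def uniformRoeAlgebra (C : CoarseStructure X) : StarSubalgebra ℂ (EllTwo X →L[ℂ] EllTwo X) :=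
  C.bandAlgebra.topologicalClosure

theorem coe_uniformRoeAlgebra (C : CoarseStructure X) :
    (C.uniformRoeAlgebra : Set (EllTwo X →L[ℂ] EllTwo X)) =
      closure (⋃ T ∈ C.controlled, bandSpace T) := rfl

instance isClosed_uniformRoeAlgebra (C : CoarseStructure X) :
    IsClosed (C.uniformRoeAlgebra : Set (EllTwo X →L[ℂ] EllTwo X)) :=
  C.bandAlgebra.isClosed_topologicalClosure

end CoarseStructure

/-- A C*-algebra `A` is nuclear if its identity map can be approximated in the point-norm topology
by compositions `A → Mₙ(ℂ) → A` of contractive completely positive maps. The order on `A` is the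
canonical one (`a ≥ 0` iff `a` is self-adjoint with nonnegative spectrum). -/
def IsNuclearCStarAlgebra (A : Type*) [NonUnitalCStarAlgebra A] : Prop :=
  letI : PartialOrder A := CStarAlgebra.spectralOrder A
  haveI : StarOrderedRing A := CStarAlgebra.spectralOrderedRing A
  ∀ (F : Finset A) (ε : ℝ), 0 < ε →
    ∃ (n : ℕ) (φ : CompletelyPositiveMap A (CStarMatrix (Fin n) (Fin n) ℂ))
      (ψ : CompletelyPositiveMap (CStarMatrix (Fin n) (Fin n) ℂ) A),
      (∀ a, ‖φ a‖ ≤ ‖a‖) ∧ (∀ m, ‖ψ m‖ ≤ ‖m‖) ∧ ∀ a ∈ F, ‖ψ (φ a) - a‖ < ε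

/-!
# Property A implies nuclearity of the uniform Roe algebra

Property A provides, for every controlled set `T` and every `ε > 0`, vectors `ξ_y ∈ ℓ²(X)`, namely
the square roots of the normalised counting functions of the slices `A_y`, which are unit vectors
with nonnegative entries, are supported uniformly close to `y`, and satisfy
`⟪ξ_y, ξ_z⟫ ≥ 1 - ε` for `(y, z) ∈ T` (`CoarseStructure.PropertyA.exists_kernel`). Write
`v x y = ξ_y(x)`, let `S` be a controlled set containing the support of `v`, and let
`S_x = {y | (x, y) ∈ S}`. Compressing an operator `a` to the blocks `ℓ²(S_x)` and gluing the blocks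
together with the weights `v` returns the Schur product of `a` with the positive definite kernel
`⟪ξ_y, ξ_z⟫`, which is close to `a` when `a ∈ E_T`.

By uniform local finiteness the blocks have at most `N` elements, so an injective labelling of each
`S_x` by `Fin N` turns the compressions into `N × N` matrices. For finitely many `a` these matrices
stay in a bounded, hence totally bounded, set; so up to a small error the matrix at `x` may be
replaced by the one at a representative `g x` taken from a finite set `t`. The resulting map factors
through `M_n(ℂ)` with `n = |t| N`:

* `φ a` is the block diagonal matrix of the compressions of `a` at the points of `t`. It is of the
  form `a ↦ [∑ r, ⟪w r p, a (w r q)⟫]` (`CompletelyPositiveMap.ofVectors`).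
* `ψ b = ∑ p q, b p q • (star (c p) * c q)` (`CompletelyPositiveMap.ofTuple`), where `c (i, p)` is
  the operator whose coefficient at `(x, y)` is `v x y` if `g x = i` and `y` has label `p` in `S_x`,
  and zero otherwise. Such a matrix has at most one nonzero entry in each row and its columns have
  `ℓ²`-norm at most one, so it defines a bounded operator; it belongs to `E_S`, and
  `∑ p, star (c p) * c p = 1`.

Complete positivity of both maps is an algebraic identity, and contractivity follows from the
normalisations of `w` and `c`. The entries of `ψ (φ a) - a` are uniformly small and supported in a
controlled set, so Schur's test (`EllTwo.norm_le_of_sum_norm_coeff_le`) bounds its norm.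
-/

/-! ### Positivity of matrices over a C⋆-algebra -/

namespace CStarMatrix

theorem ofMatrix_apply_apply {m n B : Type*} (f : m → n → B) (i : m) (j : n) :
    (ofMatrix f : CStarMatrix m n B) i j = f i j := rfl

theorem sum_apply {A m n ι : Type*} [AddCommMonoid A] (s : Finset ι)
    (f : ι → CStarMatrix m n A) (i : m) (j : n) :
    (∑ r ∈ s, f r) i j = ∑ r ∈ s, f r i j :=
  Matrix.sum_apply i j s (fun r => (f r : Matrix m n A))

/-- The embedding of `A` into `M_k(A)` as the corner at `(i₀, i₀)`. -/
noncomputable def corner {A k : Type*} [NonUnitalCStarAlgebra A] [Fintype k]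
    [DecidableEq k] (i₀ : k) : A →⋆ₙₐ[ℂ] CStarMatrix k k A where
  toFun a := ofMatrix fun i j => if i = i₀ ∧ j = i₀ then a else 0
  map_zero' := by ext i j; simp [ofMatrix_apply_apply]
  map_add' a b := by
    ext i j
    simp only [ofMatrix_apply_apply, add_apply]
    split_ifs <;> simp
  map_smul' t a := by
    ext i j
    simp only [ofMatrix_apply_apply, smul_apply]
    split_ifs <;> simp
  map_mul' a b := by
    ext i j
    simp only [CStarMatrix.mul_apply, ofMatrix_apply_apply]
    rw [Finset.sum_eq_single i₀ (fun l _ hl => by simp [hl]) (by simp)]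
    by_cases hi : i = i₀ <;> by_cases hj : j = i₀ <;> simp [hi, hj]
  map_star' a := by
    ext i j
    simp only [CStarMatrix.star_apply, ofMatrix_apply_apply]
    by_cases hi : i = i₀ <;> by_cases hj : j = i₀ <;> simp [hi, hj]

theorem corner_apply {A k : Type*} [NonUnitalCStarAlgebra A] [Fintype k]
    [DecidableEq k] (i₀ : k) (a : A) (i j : k) :
    corner i₀ a i j = if i = i₀ ∧ j = i₀ then a else 0 := rfl

variable {A : Type*} [NonUnitalCStarAlgebra A] [PartialOrder A] [StarOrderedRing A]

/-- Each row `e r` contributes `star E * E`, where `E` is the square matrix whose only nonzero row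
is `e r`. -/
theorem nonneg_of_eq_sum_star_mul {k ι : Type*} [Fintype k] [DecidableEq k] [Fintype ι]
    (M : CStarMatrix k k A) (e : ι → k → A)
    (hM : ∀ i j, M i j = ∑ r, star (e r i) * e r j) : 0 ≤ M := by
  rcases isEmpty_or_nonempty k with hk | ⟨⟨i₀⟩⟩
  · have : M = 0 := by ext i; exact hk.elim i
    exact this.ge
  let E : ι → CStarMatrix k k A := fun r => ofMatrix fun l j => if l = i₀ then e r j else 0
  have hE : ∀ r l j, E r l j = if l = i₀ then e r j else 0 := fun _ _ _ => rfl
  have h : M = ∑ r, star (E r) * E r := by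
    ext i j
    rw [hM, sum_apply]
    refine Finset.sum_congr rfl fun r _ => ?_
    rw [CStarMatrix.mul_apply, Finset.sum_eq_single i₀]
    · simp [star_apply, hE]
    · intro l _ hl
      simp [hE, hl]
    · simp
  rw [h]
  exact Finset.sum_nonneg fun r _ => star_mul_self_nonneg _

theorem exists_eq_sum_star_mul_of_nonneg {k : Type*} [Fintype k] {M : CStarMatrix k k A}
    (hM : 0 ≤ M) : ∃ d : k → k → A, ∀ i j, M i j = ∑ l, star (d l i) * d l j := by
  have key : ∀ {E : Type _} [NonUnitalCStarAlgebra E] [PartialOrder E] [StarOrderedRing E] {a : E},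
      0 ≤ a → ∃ d, a = star d * d := fun h => CStarAlgebra.nonneg_iff_eq_star_mul_self.mp h
  obtain ⟨D, rfl⟩ := key hM
  exact ⟨fun l i => D l i, fun i j => by simp [CStarMatrix.mul_apply, star_apply]⟩

end CStarMatrix

/-! ### Completely positive maps from and into matrix algebras -/

section MatrixToAlgebra

variable {A : Type*} [CStarAlgebra A] [PartialOrder A] [StarOrderedRing A]
variable {n : Type*} [Fintype n]

/-- The completely positive map `M_n(ℂ) → A`, `b ↦ ∑ p q, b p q • (star (c p) * c q)`, given by a
tuple `c` of elements of `A`. -/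
noncomputable def CompletelyPositiveMap.ofTuple (c : n → A) :
    CompletelyPositiveMap (CStarMatrix n n ℂ) A where
  toFun b := ∑ p, ∑ q, b p q • (star (c p) * c q)
  map_add' a b := by simp [add_smul, Finset.sum_add_distrib]
  map_smul' t b := by simp [Finset.smul_sum, smul_smul]
  map_cstarMatrix_nonneg' k M hM := by
    obtain ⟨d, hd⟩ := CStarMatrix.exists_eq_sum_star_mul_of_nonneg hM
    refine CStarMatrix.nonneg_of_eq_sum_star_mul (ι := Fin k × n) _
      (fun r i => ∑ p, d r.1 i r.2 p • c p) fun i j => ?_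
    have h1 : ∀ p q, M i j p q = ∑ r : Fin k × n, star (d r.1 i r.2 p) * d r.1 j r.2 q := by
      intro p q
      rw [hd, CStarMatrix.sum_apply, Fintype.sum_prod_type]
      simp [CStarMatrix.mul_apply, CStarMatrix.star_apply]
    change ∑ p, ∑ q, M i j p q • (star (c p) * c q) = _
    simp_rw [h1, Finset.sum_smul, star_sum, Finset.sum_mul_sum, star_smul, smul_mul_smul_comm]
    rw [Finset.sum_comm]
    simp_rw [Finset.sum_comm (s := (Finset.univ : Finset n))
      (t := (Finset.univ : Finset (Fin k × n)))]
    exact Finset.sum_congr rfl fun _ _ => Finset.sum_comm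

theorem CompletelyPositiveMap.ofTuple_apply (c : n → A) (b : CStarMatrix n n ℂ) :
    CompletelyPositiveMap.ofTuple c b = ∑ p, ∑ q, b p q • (star (c p) * c q) := rfl

theorem CompletelyPositiveMap.norm_ofTuple_apply_le (c : n → A)
    (hc : ‖∑ p, star (c p) * c p‖ ≤ 1) (b : CStarMatrix n n ℂ) :
    ‖CompletelyPositiveMap.ofTuple c b‖ ≤ ‖b‖ := by
  classical
  rcases isEmpty_or_nonempty n with hn | ⟨⟨p₀⟩⟩
  · simp [ofTuple_apply]
  -- With the column `K = (c p)_p`, padded to a square matrix, `∑ b p q • (star (c p) * c q)` is the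
  -- `(p₀, p₀)` entry of `star K * b * K`, and `star K * K` is the corner matrix of
  -- `∑ star (c p) * c p`.
  let K : CStarMatrix n n A := CStarMatrix.ofMatrix fun p q => if q = p₀ then c p else 0
  have hK : ∀ p q, K p q = if q = p₀ then c p else 0 := fun _ _ => rfl
  let F : CStarMatrix n n ℂ →⋆ₙₐ[ℂ] CStarMatrix n n A :=
    CStarMatrix.mapₙₐ (StarAlgHom.ofId ℂ A : ℂ →⋆ₙₐ[ℂ] A)
  have hF : ∀ p q, F b p q = algebraMap ℂ A (b p q) := fun _ _ => rfl
  have hFb : ‖F b‖ ≤ ‖b‖ := NonUnitalStarAlgHom.norm_apply_le F b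
  have hKK : ‖star K * K‖ ≤ 1 := by
    have h := NonUnitalStarAlgHom.norm_apply_le (CStarMatrix.corner (A := A) p₀)
      (∑ p, star (c p) * c p)
    refine le_trans (le_of_eq ?_) (h.trans hc)
    congr 1
    ext i j
    rw [CStarMatrix.corner_apply, CStarMatrix.mul_apply]
    by_cases hi : i = p₀ <;> by_cases hj : j = p₀ <;> simp [CStarMatrix.star_apply, hK, hi, hj]
  have hKn : ‖K‖ ≤ 1 := by
    rw [CStarRing.norm_star_mul_self] at hKK
    nlinarith [norm_nonneg K]
  have hval : ofTuple c b = (star K * F b * K) p₀ p₀ := by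
    simp only [ofTuple_apply, CStarMatrix.mul_apply, hK, hF, CStarMatrix.star_apply, if_true,
      Finset.sum_mul]
    rw [Finset.sum_comm]
    refine Finset.sum_congr rfl fun p _ => Finset.sum_congr rfl fun q _ => ?_
    rw [← Algebra.commutes, mul_assoc, Algebra.smul_def]
  rw [hval]
  calc ‖(star K * F b * K) p₀ p₀‖ ≤ ‖star K * F b * K‖ := CStarMatrix.norm_entry_le_norm
    _ ≤ ‖star K‖ * ‖F b‖ * ‖K‖ := (norm_mul_le _ _).trans (by gcongr; exact norm_mul_le _ _)
    _ ≤ 1 * ‖b‖ * 1 := by rw [norm_star]; gcongr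
    _ = ‖b‖ := by ring

end MatrixToAlgebra

section AlgebraToMatrix

variable {A : Type*} [NonUnitalCStarAlgebra A] [PartialOrder A] [StarOrderedRing A]
variable {H : Type*} [NormedAddCommGroup H] [InnerProductSpace ℂ H]
variable {n ι : Type*} [Fintype n] [Fintype ι]

/-- A Gram matrix indexed by `k × n`, regarded as an element of `M_k(M_n(ℂ))`, is nonnegative. -/
theorem CStarMatrix.nonneg_of_eq_inner {k : Type*} [Fintype k] [DecidableEq k]
    (M : CStarMatrix k k (CStarMatrix n n ℂ)) (v : k → n → H)
    (hM : ∀ i j p q, M i j p q = ⟪v i p, v j q⟫_ℂ) : 0 ≤ M := by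
  classical
  rcases isEmpty_or_nonempty n with hn | ⟨⟨p₀⟩⟩
  · have : M = 0 := by ext i j p; exact hn.elim p
    exact this.ge
  obtain ⟨m, D, hD⟩ := Matrix.posSemidef_iff_eq_sum_vecMulVec.mp
    (Matrix.posSemidef_gram ℂ fun x : k × n => v x.1 x.2)
  let e : Fin m → k → CStarMatrix n n ℂ := fun r i =>
    CStarMatrix.ofMatrix fun s p => if s = p₀ then star (D r (i, p)) else 0
  have he : ∀ r i s p, e r i s p = if s = p₀ then star (D r (i, p)) else 0 :=
    fun _ _ _ _ => rfl
  refine CStarMatrix.nonneg_of_eq_sum_star_mul M e fun i j => ?_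
  ext p q
  have h := congrFun (congrFun hD (i, p)) (j, q)
  rw [Matrix.gram_apply, Matrix.sum_apply] at h
  rw [hM, h, CStarMatrix.sum_apply]
  refine Finset.sum_congr rfl fun r _ => ?_
  rw [CStarMatrix.mul_apply, Finset.sum_eq_single p₀]
  · simp [Matrix.vecMulVec_apply, CStarMatrix.star_apply, he]
  · intro s _ hs
    simp [he, hs]
  · simp

variable [CompleteSpace H]

/-- The completely positive map `A → M_n(ℂ)`, `a ↦ [∑ r, ⟪w r p, π a (w r q)⟫]`, given by a
representation `π` of `A` and families `w r` of `n` vectors: the sum of the compressions of `π` by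
the maps `ℂⁿ → H` sending the basis vectors to `w r p`. -/
noncomputable def CompletelyPositiveMap.ofVectors (π : A →⋆ₙₐ[ℂ] (H →L[ℂ] H)) (w : ι → n → H) :
    CompletelyPositiveMap A (CStarMatrix n n ℂ) where
  toFun a := CStarMatrix.ofMatrix fun p q => ∑ r, ⟪w r p, π a (w r q)⟫_ℂ
  map_add' a b := by
    ext p q
    simp only [CStarMatrix.add_apply, CStarMatrix.ofMatrix_apply_apply]
    simp [Finset.sum_add_distrib]
  map_smul' t b := by
    ext p q
    simp only [CStarMatrix.smul_apply, CStarMatrix.ofMatrix_apply_apply]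
    simp [Finset.mul_sum]
  map_cstarMatrix_nonneg' k M hM := by
    obtain ⟨d, hd⟩ := CStarMatrix.exists_eq_sum_star_mul_of_nonneg hM
    let N : ι × Fin k → CStarMatrix (Fin k) (Fin k) (CStarMatrix n n ℂ) := fun x =>
      CStarMatrix.ofMatrix fun i j => CStarMatrix.ofMatrix fun p q =>
        ⟪π (d x.2 i) (w x.1 p), π (d x.2 j) (w x.1 q)⟫_ℂ
    have hN : ∀ x, 0 ≤ N x := fun x =>
      CStarMatrix.nonneg_of_eq_inner (N x) (fun i p => π (d x.2 i) (w x.1 p)) fun _ _ _ _ => rfl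
    refine (Finset.sum_nonneg fun x (_ : x ∈ Finset.univ) => hN x).trans_eq ?_
    ext i j p q
    rw [CStarMatrix.sum_apply, CStarMatrix.sum_apply, Fintype.sum_prod_type]
    change _ = ∑ r, ⟪w r p, π (M i j) (w r q)⟫_ℂ
    refine Finset.sum_congr rfl fun r _ => ?_
    rw [hd, map_sum, _root_.sum_apply, inner_sum]
    refine Finset.sum_congr rfl fun l _ => ?_
    rw [map_mul, map_star, ContinuousLinearMap.star_eq_adjoint]
    exact (ContinuousLinearMap.adjoint_inner_right _ _ _).symm

theorem CompletelyPositiveMap.ofVectors_apply (π : A →⋆ₙₐ[ℂ] (H →L[ℂ] H)) (w : ι → n → H)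
    (a : A) (p q : n) :
    CompletelyPositiveMap.ofVectors π w a p q = ∑ r, ⟪w r p, π a (w r q)⟫_ℂ := rfl

/-- The hypothesis says that the column of the maps `W_r : ℂⁿ → H`, `W_r t = ∑ p, t p • w r p`, is a
contraction. -/
theorem CompletelyPositiveMap.norm_ofVectors_apply_le (π : A →⋆ₙₐ[ℂ] (H →L[ℂ] H)) (w : ι → n → H)
    (hw : ∀ t : n → ℂ, ∑ r, ‖∑ p, t p • w r p‖ ^ 2 ≤ ∑ p, ‖t p‖ ^ 2) (a : A) :
    ‖CompletelyPositiveMap.ofVectors π w a‖ ≤ ‖a‖ := by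
  refine CStarMatrix.norm_le_of_forall_inner_le (C := ‖a‖₊) fun x y => ?_
  have e : ⟪y, CStarMatrix.toCLM (ofVectors π w a) x⟫_ℂ =
      ∑ r, ⟪∑ p, star (x p) • w r p, π a (∑ q, star (y q) • w r q)⟫_ℂ := by
    -- The inner product on the left is that of the Hilbert `ℂ`-module, which unfolds to
    -- `⟪s, t⟫ = t * star s`; matrices act on row vectors.
    have e1 : ⟪y, CStarMatrix.toCLM (ofVectors π w a) x⟫_ℂ =
        ∑ q, (∑ p, x p * ∑ r, ⟪w r p, π a (w r q)⟫_ℂ) * star (y q) := by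
      rw [CStarMatrix.toCLM_apply_eq_sum]
      rfl
    rw [e1]
    simp only [map_sum, sum_inner, inner_sum, inner_smul_left, inner_smul_right, map_smul,
      Finset.mul_sum, Finset.sum_mul]
    rw [Finset.sum_congr rfl fun q _ => Finset.sum_comm, Finset.sum_comm]
    refine Finset.sum_congr rfl fun r _ => Finset.sum_congr rfl fun q _ =>
      Finset.sum_congr rfl fun p _ => ?_
    rw [starRingEnd_apply, star_star]
    ring
  have hn : ∀ z : WithCStarModule ℂ (n → ℂ), ‖z‖ ^ 2 = ∑ p, ‖star (z p)‖ ^ 2 := by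
    intro z
    have h1 : ∑ p, ⟪z p, z p⟫_ℂ = ((∑ p, ‖star (z p)‖ ^ 2 : ℝ) : ℂ) := by
      push_cast
      refine Finset.sum_congr rfl fun p _ => ?_
      rw [norm_star, ← Complex.mul_conj']
      rfl
    rw [WithCStarModule.pi_norm_sq, h1, Complex.norm_real, Real.norm_of_nonneg (by positivity)]
  have hB : ‖π a‖ ≤ ‖a‖ := NonUnitalStarAlgHom.norm_apply_le π a
  rw [e]
  calc _ ≤ ∑ r, ‖⟪∑ p, star (x p) • w r p, π a (∑ q, star (y q) • w r q)⟫_ℂ‖ := norm_sum_le _ _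
    _ ≤ ∑ r, ‖a‖ * (‖∑ p, star (x p) • w r p‖ * ‖∑ q, star (y q) • w r q‖) := by
      refine Finset.sum_le_sum fun r _ => (norm_inner_le_norm _ _).trans ?_
      rw [mul_left_comm]
      gcongr
      exact (ContinuousLinearMap.le_opNorm _ _).trans (by gcongr)
    _ ≤ ‖a‖ * (√(∑ r, ‖∑ p, star (x p) • w r p‖ ^ 2) * √(∑ r, ‖∑ q, star (y q) • w r q‖ ^ 2)) := by
      rw [← Finset.mul_sum]
      gcongr
      exact Real.sum_mul_le_sqrt_mul_sqrt _ _ _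
    _ ≤ ‖a‖ * (√(‖x‖ ^ 2) * √(‖y‖ ^ 2)) := by
      rw [hn x, hn y]
      gcongr <;> exact hw _
    _ = ‖a‖₊ * ‖x‖ * ‖y‖ := by
      rw [Real.sqrt_sq (norm_nonneg _), Real.sqrt_sq (norm_nonneg _), coe_nnnorm]; ring

end AlgebraToMatrix

/-! ### Operators on `ℓ²(X)` -/

namespace EllTwo

variable {X : Type*}

theorem coeff_eq_apply (a : EllTwo X →L[ℂ] EllTwo X) (x y : X) :
    coeff a x y = a (delta y) x := inner_delta_left _ _

theorem delta_apply [DecidableEq X] (x y : X) : delta y x = if x = y then 1 else 0 := by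
  by_cases h : x = y
  · subst h; simp [delta, lp.single_apply]
  · simp [delta, lp.single_apply, h]

theorem inner_delta_delta [DecidableEq X] (x y : X) :
    ⟪delta x, delta y⟫_ℂ = if x = y then 1 else 0 := by
  rw [inner_delta_left, delta_apply]

theorem norm_delta (x : X) : ‖delta x‖ = 1 := by
  classical
  rw [delta, lp.norm_single (by norm_num)]
  simp

theorem norm_coeff_le (a : EllTwo X →L[ℂ] EllTwo X) (x y : X) : ‖coeff a x y‖ ≤ ‖a‖ := by
  have h := (norm_inner_le_norm (𝕜 := ℂ) (delta x) (a (delta y))).trans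
    (mul_le_mul_of_nonneg_left (a.le_opNorm _) (norm_nonneg _))
  rwa [norm_delta, norm_delta, mul_one, one_mul] at h

theorem sum_sq_le_norm_sq (f : EllTwo X) (s : Finset X) : ∑ x ∈ s, ‖f x‖ ^ 2 ≤ ‖f‖ ^ 2 := by
  have h := lp.sum_rpow_le_norm_rpow (p := 2) (by norm_num) f s
  simpa using h

theorem hasSum_smul_delta (f : EllTwo X) : HasSum (fun x => f x • delta x) f := by
  classical
  have h := lp.hasSum_single (p := 2) (by norm_num) f
  convert h using 1
  ext x y
  by_cases hy : y = x
  · subst hy; simp [delta_apply, lp.single_apply]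
  · simp [delta_apply, lp.single_apply, hy]

/-- **Schur's test**: an operator whose matrix has absolute row and column sums at most `R` has norm
at most `R`. -/
theorem norm_le_of_sum_norm_coeff_le (d : EllTwo X →L[ℂ] EllTwo X) {R : ℝ} (hR : 0 ≤ R)
    (hrow : ∀ x, ∀ s : Finset X, ∑ y ∈ s, ‖coeff d x y‖ ≤ R)
    (hcol : ∀ y, ∀ s : Finset X, ∑ x ∈ s, ‖coeff d x y‖ ≤ R) : ‖d‖ ≤ R := by
  have key : ∀ f g : EllTwo X, ‖⟪g, d f⟫_ℂ‖ ≤ R * ‖f‖ * ‖g‖ := by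
    intro f g
    have hlim : Filter.Tendsto (fun s : Finset X =>
        ‖⟪∑ x ∈ s, g x • delta x, d (∑ y ∈ s, f y • delta y)⟫_ℂ‖) Filter.atTop
        (nhds ‖⟪g, d f⟫_ℂ‖) :=
      (Filter.Tendsto.inner (hasSum_smul_delta g)
        ((d.continuous.tendsto _).comp (hasSum_smul_delta f))).norm
    refine le_of_tendsto' hlim fun s => ?_
    -- It suffices to treat finitely supported vectors, where Cauchy-Schwarz is applied to
    -- `√|d x y| |f y|` and `√|d x y| |g x|`.
    have e : ⟪∑ x ∈ s, g x • delta x, d (∑ y ∈ s, f y • delta y)⟫_ℂ =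
        ∑ x ∈ s, ∑ y ∈ s, star (g x) * (f y * coeff d x y) := by
      simp only [map_sum, map_smul, sum_inner]
      simp only [inner_sum, inner_smul_left, inner_smul_right, coeff]
      refine Finset.sum_congr rfl fun x _ => Finset.sum_congr rfl fun y _ => ?_
      rw [mul_left_comm]
      rfl
    have hs : ∀ t : ℝ, 0 ≤ t → √t * √t = t := fun t ht => Real.mul_self_sqrt ht
    rw [e, ← Finset.sum_product']
    calc _ ≤ ∑ z ∈ s ×ˢ s, (√‖coeff d z.1 z.2‖ * ‖f z.2‖) * (√‖coeff d z.1 z.2‖ * ‖g z.1‖) := by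
          refine (norm_sum_le _ _).trans (Finset.sum_le_sum fun z _ => le_of_eq ?_)
          rw [mul_mul_mul_comm, hs _ (norm_nonneg _), norm_mul, norm_mul, norm_star]
          ring
      _ ≤ √(∑ z ∈ s ×ˢ s, (√‖coeff d z.1 z.2‖ * ‖f z.2‖) ^ 2) *
          √(∑ z ∈ s ×ˢ s, (√‖coeff d z.1 z.2‖ * ‖g z.1‖) ^ 2) :=
        Real.sum_mul_le_sqrt_mul_sqrt _ _ _
      _ ≤ √(R * ‖f‖ ^ 2) * √(R * ‖g‖ ^ 2) := by
        simp only [mul_pow, Real.sq_sqrt (norm_nonneg _)]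
        gcongr
        · rw [Finset.sum_product_right]
          simp only [← Finset.sum_mul]
          refine le_trans (Finset.sum_le_sum fun y _ =>
            mul_le_mul_of_nonneg_right (hcol y s) (by positivity)) ?_
          rw [← Finset.mul_sum]
          exact mul_le_mul_of_nonneg_left (sum_sq_le_norm_sq f s) hR
        · rw [Finset.sum_product]
          simp only [← Finset.sum_mul]
          refine le_trans (Finset.sum_le_sum fun y _ =>
            mul_le_mul_of_nonneg_right (hrow y s) (by positivity)) ?_
          rw [← Finset.mul_sum]
          exact mul_le_mul_of_nonneg_left (sum_sq_le_norm_sq g s) hR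
      _ = R * ‖f‖ * ‖g‖ := by
        rw [Real.sqrt_mul hR, Real.sqrt_mul hR, Real.sqrt_sq (norm_nonneg _),
          Real.sqrt_sq (norm_nonneg _), mul_mul_mul_comm, hs R hR, mul_assoc]
  refine d.opNorm_le_bound hR fun f => ?_
  rcases eq_or_lt_of_le (norm_nonneg (d f)) with h | h
  · rw [← h]; positivity
  · have := key f (d f)
    rw [inner_self_eq_norm_sq_to_K] at this
    refine le_of_mul_le_mul_right (le_trans (le_of_eq ?_) this) h
    simp [sq]

/-- A matrix with at most one nonzero entry in each row and columns of `ℓ²`-norm at most one defines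
a contraction: it is the weighted composition operator `f ↦ (x ↦ m x (σ x) * f (σ x))`. -/
theorem exists_coeff_eq_of_row_subsingleton (m : X → X → ℂ)
    (hrow : ∀ x y z, m x y ≠ 0 → m x z ≠ 0 → y = z)
    (hcol : ∀ y, ∀ s : Finset X, ∑ x ∈ s, ‖m x y‖ ^ 2 ≤ 1) :
    ∃ a : EllTwo X →L[ℂ] EllTwo X, ∀ x y, coeff a x y = m x y := by
  classical
  have hex : ∀ x, ∃ y₀, ∀ y, m x y ≠ 0 → y = y₀ := fun x => by
    by_cases h : ∃ y, m x y ≠ 0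
    · obtain ⟨y₀, h₀⟩ := h
      exact ⟨y₀, fun y hy => hrow x y y₀ hy h₀⟩
    · exact ⟨x, fun y hy => (h ⟨y, hy⟩).elim⟩
  choose σ hσ using hex
  have hsum : ∀ (f : EllTwo X) (s : Finset X), ∑ x ∈ s, ‖m x (σ x) * f (σ x)‖ ^ 2 ≤ ‖f‖ ^ 2 := by
    intro f s
    calc _ ≤ ∑ x ∈ s, ∑ y ∈ s.image σ, ‖m x y‖ ^ 2 * ‖f y‖ ^ 2 := by
          refine Finset.sum_le_sum fun x hx => ?_
          rw [norm_mul, mul_pow]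
          exact Finset.single_le_sum (f := fun y => ‖m x y‖ ^ 2 * ‖f y‖ ^ 2)
            (fun y _ => by positivity) (Finset.mem_image_of_mem σ hx)
      _ = ∑ y ∈ s.image σ, (∑ x ∈ s, ‖m x y‖ ^ 2) * ‖f y‖ ^ 2 := by
          rw [Finset.sum_comm]
          simp only [Finset.sum_mul]
      _ ≤ ∑ y ∈ s.image σ, ‖f y‖ ^ 2 := by
          refine Finset.sum_le_sum fun y _ => ?_
          exact mul_le_of_le_one_left (by positivity) (hcol y s)
      _ ≤ ‖f‖ ^ 2 := sum_sq_le_norm_sq f _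
  have hmem : ∀ f : EllTwo X, Memℓp (fun x => m x (σ x) * f (σ x)) 2 := fun f =>
    memℓp_gen' (C := ‖f‖ ^ 2) fun s => by simpa using hsum f s
  let A : EllTwo X →ₗ[ℂ] EllTwo X :=
    { toFun := fun f => ⟨fun x => m x (σ x) * f (σ x), hmem f⟩
      map_add' := fun f g => by
        ext x
        exact mul_add _ _ _
      map_smul' := fun c f => by
        ext x
        exact mul_left_comm _ _ _ }
  have hA : ∀ f x, A f x = m x (σ x) * f (σ x) := fun _ _ => rfl
  refine ⟨A.mkContinuous 1 fun f => ?_, fun x y => ?_⟩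
  · rw [one_mul]
    refine lp.norm_le_of_forall_sum_le (by norm_num) (norm_nonneg f) fun s => ?_
    simpa [hA] using hsum f s
  · rw [coeff_eq_apply]
    change A (delta y) x = _
    rw [hA, delta_apply]
    by_cases h : σ x = y
    · simp [h]
    · have h0 : m x y = 0 := by
        by_contra h0
        exact h (hσ x y h0).symm
      simp [h, h0]

end EllTwo

/-! ### Consequences of uniform local finiteness and property A -/

namespace CoarseStructure

variable {X : Type*} {C : CoarseStructure X}

theorem UniformlyLocallyFinite.exists_bound (h : C.UniformlyLocallyFinite) {T : SetRel X X}
    (hT : T ∈ C.controlled) : ∃ N : ℕ, ∀ x, (fiber T x).encard ≤ N := by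
  obtain ⟨N, hN⟩ := ENat.ne_top_iff_exists.mp (h T hT).ne
  exact ⟨N, fun x => hN ▸ le_iSup (fun x => (fiber T x).encard) x⟩

/-- Rows and columns of a controlled set are uniformly finite. -/
theorem UniformlyLocallyFinite.exists_card_le (h : C.UniformlyLocallyFinite) {T : SetRel X X}
    (hT : T ∈ C.controlled) :
    ∃ N : ℕ, (∀ x (s : Finset X), (∀ y ∈ s, (x, y) ∈ T) → s.card ≤ N) ∧
      ∀ y (s : Finset X), (∀ x ∈ s, (x, y) ∈ T) → s.card ≤ N := by
  obtain ⟨N₁, h₁⟩ := h.exists_bound (C.inv_mem T hT)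
  obtain ⟨N₂, h₂⟩ := h.exists_bound hT
  have key : ∀ (N : ℕ) (S : Set X) (s : Finset X), S.encard ≤ N → (∀ y ∈ s, y ∈ S) →
      s.card ≤ N := fun N S s hS hs => by
    have := (Set.encard_le_encard (show (s : Set X) ⊆ S from hs)).trans hS
    rw [Set.encard_coe_eq_coe_finsetCard] at this
    exact_mod_cast this
  exact ⟨max N₁ N₂, fun x s hs => (key N₁ _ s (h₁ x) hs).trans (le_max_left _ _),
    fun y s hs => (key N₂ _ s (h₂ y) hs).trans (le_max_right _ _)⟩

/-- The rows of a controlled set can be labelled injectively by finitely many labels. -/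
theorem UniformlyLocallyFinite.exists_labelling (h : C.UniformlyLocallyFinite) {S : SetRel X X}
    (hS : S ∈ C.controlled) :
    ∃ (N : ℕ) (l : X → X → Fin N),
      ∀ x y z, (x, y) ∈ S → (x, z) ∈ S → l x y = l x z → y = z := by
  obtain ⟨N, hN⟩ := h.exists_bound (C.inv_mem S hS)
  have hx : ∀ x, ∃ f : X → Fin (N + 1), Set.InjOn f (fiber S.inv x) := by
    intro x
    have hf : (fiber S.inv x).Finite := Set.finite_of_encard_le_coe (hN x)
    have hc : (fiber S.inv x).ncard ≤ N := by
      have := hN x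
      rw [← hf.cast_ncard_eq] at this
      exact_mod_cast this
    have := hf.fintype
    have e : Fintype.card (fiber S.inv x) ≤ Fintype.card (Fin (N + 1)) := by
      rw [Fintype.card_fin, ← Nat.card_eq_fintype_card]
      exact hc.trans (Nat.le_succ N)
    obtain ⟨g⟩ := Function.Embedding.nonempty_of_card_le e
    classical
    refine ⟨fun y => if hy : y ∈ fiber S.inv x then g ⟨y, hy⟩ else 0, fun y hy z hz hyz => ?_⟩
    simp only [hy, hz, dif_pos] at hyz
    exact congrArg Subtype.val (g.injective hyz)
  choose f hf using hx
  exact ⟨N + 1, f, fun x y z hy hz => @hf x y hy z hz⟩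

/-- The unit vectors `ξ_y = v · y` attached to property A, with the finite sets `s y` containing
their supports. They are `ξ_y(x) = √(#{n | (x, n) ∈ A_y} / #A_y)`. -/
theorem PropertyA.exists_kernel (hA : C.PropertyA) {ε : ℝ} (hε : 0 < ε) {T : SetRel X X}
    (hT : T ∈ C.controlled) :
    ∃ S ∈ C.controlled, ∃ (v : X → X → ℝ) (s : X → Finset X),
      (∀ x y, 0 ≤ v x y) ∧ (∀ x y, v x y ≠ 0 → (x, y) ∈ S) ∧ (∀ x y, v x y ≠ 0 → x ∈ s y) ∧
      (∀ y, ∑ x ∈ s y, v x y ^ 2 = 1) ∧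
      ∀ y z, (y, z) ∈ T → 1 - ε ≤ ∑ x ∈ s y, v x y * v x z := by
  classical
  obtain ⟨S, hS, A, hAS, hfin, hdiag, hT'⟩ := hA ε hε T hT
  let B : X → Finset (X × ℕ) := fun y => (hfin y).toFinset
  have hB : ∀ y p, p ∈ B y ↔ ((y, p.1), p.2) ∈ A := fun y p => (hfin y).mem_toFinset
  have hBcoe : ∀ y, (B y : Set (X × ℕ)) = slice A y := fun y => (hfin y).coe_toFinset
  let n : X → X → Finset (X × ℕ) := fun x y => (B y).filter fun p => p.1 = x
  have hpos : ∀ y, 0 < ((B y).card : ℝ) := fun y => by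
    have : (B y).Nonempty := ⟨(y, 1), (hB y _).mpr (hdiag y)⟩
    exact_mod_cast this.card_pos
  have hne : ∀ x y, √((n x y).card / (B y).card) ≠ 0 → ∃ p ∈ B y, p.1 = x := by
    intro x y h
    by_contra! h'
    apply h
    have : n x y = ∅ := Finset.filter_eq_empty_iff.mpr fun p hp => h' p hp
    simp [this]
  have hsq : ∀ x y, √((n x y).card / (B y).card) ^ 2 = ((n x y).card : ℝ) / (B y).card :=
    fun x y => Real.sq_sqrt (by positivity)
  refine ⟨S.inv, C.inv_mem S hS, fun x y => √((n x y).card / (B y).card),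
    fun y => (B y).image Prod.fst, fun x y => Real.sqrt_nonneg _, fun x y h => ?_, fun x y h => ?_,
    fun y => ?_, fun y z hyz => ?_⟩
  · obtain ⟨p, hp, rfl⟩ := hne x y h
    exact (hAS ((hB y p).mp hp)).1
  · obtain ⟨p, hp, rfl⟩ := hne x y h
    exact Finset.mem_image_of_mem _ hp
  · simp only [hsq]
    rw [← Finset.sum_div, ← Nat.cast_sum, ← Finset.card_eq_sum_card_image, div_self (hpos y).ne']
  · have h := hT' y z hyz
    rw [← hBcoe, ← hBcoe, ← Finset.coe_symmDiff, ← Finset.coe_inter, Set.ncard_coe_finset,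
      Set.ncard_coe_finset] at h
    set I := B y ∩ B z with hI
    set m : ℝ := max (B y).card (B z).card with hm
    have hmpos : 0 < m := (hpos y).trans_le (le_max_left _ _)
    have hI1 : m ≤ I.card + (symmDiff (B y) (B z)).card := by
      have h1 : B y ⊆ I ∪ symmDiff (B y) (B z) := fun p hp => by
        by_cases hz : p ∈ B z <;> simp [hI, Finset.mem_symmDiff, hp, hz]
      have h2 : B z ⊆ I ∪ symmDiff (B y) (B z) := fun p hp => by
        by_cases hz : p ∈ B y <;> simp [hI, Finset.mem_symmDiff, hp, hz]
      refine max_le ?_ ?_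
      · exact_mod_cast (Finset.card_le_card h1).trans (Finset.card_union_le _ _)
      · exact_mod_cast (Finset.card_le_card h2).trans (Finset.card_union_le _ _)
    have hIm : (1 - ε) * m ≤ I.card := by
      by_cases h1 : 1 - ε ≤ 0
      · exact (mul_nonpos_of_nonpos_of_nonneg h1 hmpos.le).trans (Nat.cast_nonneg _)
      · have : (0 : ℝ) ≤ I.card := Nat.cast_nonneg _
        push Not at h1
        nlinarith
    -- `⟪ξ_y, ξ_z⟫ ≥ #(A_y ∩ A_z) / max (#A_y) (#A_z)`, fibre by fibre over `X`.
    calc 1 - ε ≤ I.card / m := (le_div_iff₀ hmpos).mpr hIm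
      _ = ∑ x ∈ (B y).image Prod.fst, ((I.filter fun p => p.1 = x).card : ℝ) / m := by
        rw [← Finset.sum_div, ← Nat.cast_sum]
        congr 2
        convert! Finset.card_eq_sum_card_fiberwise (f := Prod.fst) (s := I)
          (t := (B y).image Prod.fst) fun p hp =>
            Finset.mem_image_of_mem _ (Finset.mem_inter.mp hp).1
      _ ≤ _ := by
        refine Finset.sum_le_sum fun x _ => ?_
        have hle : ∀ w, (w = y ∨ w = z) →
            √((I.filter fun p => p.1 = x).card / m) ≤ √((n x w).card / (B w).card) := by
          intro w hw
          refine Real.sqrt_le_sqrt ?_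
          refine div_le_div₀ (Nat.cast_nonneg _) ?_ (hpos w) ?_
          · refine Nat.cast_le.mpr (Finset.card_le_card (Finset.filter_subset_filter _ ?_))
            rcases hw with rfl | rfl
            · exact Finset.inter_subset_left
            · exact Finset.inter_subset_right
          · rcases hw with rfl | rfl
            · exact le_max_left _ _
            · exact le_max_right _ _
        calc _ = √((I.filter fun p => p.1 = x).card / m) *
                √((I.filter fun p => p.1 = x).card / m) :=
              (Real.mul_self_sqrt (by positivity)).symm
          _ ≤ _ := mul_le_mul (hle y (Or.inl rfl)) (hle z (Or.inr rfl)) (Real.sqrt_nonneg _)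
            (Real.sqrt_nonneg _)

end CoarseStructure

/-! ### Nuclearity from tuples -/

/-- Nuclearity from approximate factorisations through `ofVectors` and `ofTuple`. Since these maps
are contractive, it is enough to approximate elements near those of the finite set. -/
theorem isNuclearCStarAlgebra_of_exists_tuple {A : Type*} [CStarAlgebra A] {H : Type*}
    [NormedAddCommGroup H] [InnerProductSpace ℂ H] [CompleteSpace H]
    (π : A →⋆ₙₐ[ℂ] (H →L[ℂ] H))
    (h : ∀ (F : Finset A) (ε : ℝ), 0 < ε → ∃ (n : ℕ) (ι : Type) (_ : Fintype ι) (c : Fin n → A)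
      (w : ι → Fin n → H), ‖∑ p, star (c p) * c p‖ ≤ 1 ∧
      (∀ t : Fin n → ℂ, ∑ r, ‖∑ p, t p • w r p‖ ^ 2 ≤ ∑ p, ‖t p‖ ^ 2) ∧
      ∀ a ∈ F, ∃ b, ‖a - b‖ < ε ∧
        ‖∑ p, ∑ q, (∑ r, ⟪w r p, π b (w r q)⟫_ℂ) • (star (c p) * c q) - b‖ ≤ ε) :
    IsNuclearCStarAlgebra A := by
  let _ : PartialOrder A := CStarAlgebra.spectralOrder A
  have : StarOrderedRing A := CStarAlgebra.spectralOrderedRing A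
  intro F ε hε
  obtain ⟨n, ι, _, c, w, hc, hw, hF⟩ := h F (ε / 3) (by positivity)
  have hφ := CompletelyPositiveMap.norm_ofVectors_apply_le π w hw
  have hψ := CompletelyPositiveMap.norm_ofTuple_apply_le c hc
  refine ⟨n, .ofVectors π w, .ofTuple c, hφ, hψ, fun a ha => ?_⟩
  obtain ⟨b, hab, hb⟩ := hF a ha
  set φ := CompletelyPositiveMap.ofVectors π w
  set ψ := CompletelyPositiveMap.ofTuple c
  have hb' : ‖ψ (φ b) - b‖ ≤ ε / 3 := hb
  have e : ψ (φ a) - a = ψ (φ (a - b)) + (ψ (φ b) - b) - (a - b) := by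
    rw [map_sub, map_sub]
    abel
  rw [e]
  calc _ ≤ ‖ψ (φ (a - b))‖ + ‖ψ (φ b) - b‖ + ‖a - b‖ :=
        (norm_sub_le _ _).trans (by gcongr; exact norm_add_le _ _)
    _ ≤ ‖a - b‖ + ε / 3 + ‖a - b‖ := by
        gcongr
        exact (hψ _).trans (hφ _)
    _ < ε := by linarith

/-! ### Finite nets and orthogonal families -/

theorem exists_finset_net {X E : Type*} [PseudoMetricSpace E] [ProperSpace E] (f : X → E)
    (hf : Bornology.IsBounded (Set.range f)) {δ : ℝ} (hδ : 0 < δ) :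
    ∃ t : Finset X, ∀ x, ∃ i ∈ t, dist (f x) (f i) < δ := by
  have h := Metric.finite_approx_of_totallyBounded
    (hf.isCompact_closure.totallyBounded.subset subset_closure) δ hδ
  rw [← Set.image_univ, Set.exists_subset_image_finite_and] at h
  obtain ⟨t, -, ht, hcover⟩ := h
  refine ⟨ht.toFinset, fun x => ?_⟩
  simpa using hcover (Set.mem_image_of_mem f (Set.mem_univ x))

theorem norm_sq_sum_smul_le_of_orthogonal {ι H : Type*} [Fintype ι] [NormedAddCommGroup H]
    [InnerProductSpace ℂ H] (w : ι → H) (hw : ∀ p q, p ≠ q → ⟪w p, w q⟫_ℂ = 0)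
    (hn : ∀ p, ‖w p‖ ≤ 1) (t : ι → ℂ) : ‖∑ p, t p • w p‖ ^ 2 ≤ ∑ p, ‖t p‖ ^ 2 := by
  have h : ⟪∑ p, t p • w p, ∑ p, t p • w p⟫_ℂ = ((∑ p, ‖t p‖ ^ 2 * ‖w p‖ ^ 2 : ℝ) : ℂ) := by
    push_cast
    rw [sum_inner]
    refine Finset.sum_congr rfl fun p _ => ?_
    rw [inner_sum, Finset.sum_eq_single p]
    · rw [inner_self_eq_norm_sq_to_K, norm_smul]
      push_cast
      exact mul_pow _ _ _
    · intro q _ hq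
      rw [inner_smul_left, inner_smul_right, hw p q hq.symm, mul_zero, mul_zero]
    · simp
  rw [inner_self_eq_norm_sq_to_K] at h
  have h' : ‖∑ p, t p • w p‖ ^ 2 = ∑ p, ‖t p‖ ^ 2 * ‖w p‖ ^ 2 := by
    refine Complex.ofReal_injective (Eq.trans ?_ h)
    push_cast
    rfl
  rw [h']
  exact Finset.sum_le_sum fun p _ =>
    mul_le_of_le_one_right (by positivity) (pow_le_one₀ (norm_nonneg _) (hn p))

/-! ### Coefficients of glued operators -/

namespace EllTwo

variable {X : Type*}

theorem coeff_sub (a b : EllTwo X →L[ℂ] EllTwo X) (x y : X) :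
    coeff (a - b) x y = coeff a x y - coeff b x y := by
  simp only [coeff, _root_.sub_apply, inner_sub_right]

theorem coeff_sum_sum_smul {n : Type*} [Fintype n] (b : n → n → ℂ)
    (a : n → n → EllTwo X →L[ℂ] EllTwo X) (x y : X) :
    coeff (∑ p, ∑ q, b p q • a p q) x y = ∑ p, ∑ q, b p q * coeff (a p q) x y := by
  simp only [coeff, _root_.sum_apply, _root_.smul_apply, inner_sum, inner_smul_right]

/-- If `c (i, p)` has coefficients `v x y` at the points with `g x = i` and `l x y = p`, then gluing
with `c` uses, in row `x`, only the block of `b` at `g x`. -/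
theorem coeff_sum_block {I L : Type*} [Fintype I] [DecidableEq I] [Fintype L] [DecidableEq L]
    {v : X → X → ℝ} {s : X → Finset X} (hs : ∀ x y, v x y ≠ 0 → x ∈ s y)
    (g : X → I) (l : X → X → L) (c : I × L → EllTwo X →L[ℂ] EllTwo X)
    (hc : ∀ P x y, coeff (c P) x y = if P = (g x, l x y) then (v x y : ℂ) else 0)
    (b : I × L → I × L → ℂ) (y z : X) :
    coeff (∑ P, ∑ Q, b P Q • (star (c P) * c Q)) y z =
      ∑ x ∈ s y, (v x y * v x z : ℂ) * b (g x, l x y) (g x, l x z) := by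
  have h1 : ∀ P Q, coeff (star (c P) * c Q) y z =
      ∑ x ∈ s y, star (coeff (c P) x y) * coeff (c Q) x z := by
    intro P Q
    rw [coeff_mul]
    simp only [coeff_star]
    refine tsum_eq_sum fun x hx => ?_
    have : v x y = 0 := by
      by_contra h0
      exact hx (hs x y h0)
    simp [hc, this]
  rw [coeff_sum_sum_smul]
  simp only [h1, Finset.mul_sum]
  rw [Finset.sum_congr rfl fun P _ => Finset.sum_comm, Finset.sum_comm]
  refine Finset.sum_congr rfl fun x _ => ?_
  rw [Finset.sum_eq_single (g x, l x y), Finset.sum_eq_single (g x, l x z)]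
  · simp only [hc, if_true]
    rw [Complex.star_def, Complex.conj_ofReal]
    ring
  · intro Q _ hQ
    simp [hc, hQ]
  · simp
  · intro P _ hP
    simp [hc, hP]
  · simp

end EllTwo

/-! ### Approximate factorisation of the uniform Roe algebra -/

namespace CoarseStructure

variable {X : Type*} {C : CoarseStructure X}

/-- The approximate factorisation of finitely many operators in `E_T`, given by explicit data for
`CompletelyPositiveMap.ofTuple` and `CompletelyPositiveMap.ofVectors`. -/
theorem exists_tuple_of_mem_bandSpace (hfin : C.UniformlyLocallyFinite) (hA : C.PropertyA)
    {T : SetRel X X} (hT : T ∈ C.controlled) {J : Type*} [Fintype J]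
    (a : J → EllTwo X →L[ℂ] EllTwo X) (ha : ∀ j, a j ∈ bandSpace T) {ε : ℝ} (hε : 0 < ε) :
    ∃ (n : ℕ) (m : ℕ) (c : Fin n → EllTwo X →L[ℂ] EllTwo X)
      (w : Fin m → Fin n → EllTwo X), (∀ p, c p ∈ C.bandAlgebra) ∧
      ‖∑ p, star (c p) * c p‖ ≤ 1 ∧
      (∀ t : Fin n → ℂ, ∑ r, ‖∑ p, t p • w r p‖ ^ 2 ≤ ∑ p, ‖t p‖ ^ 2) ∧
      ∀ j, ‖∑ p, ∑ q, (∑ r, ⟪w r p, a j (w r q)⟫_ℂ) • (star (c p) * c q) - a j‖ ≤ ε := by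
  classical
  set K : ℝ := ∑ j, ‖a j‖ with hK
  have hK0 : 0 ≤ K := Finset.sum_nonneg fun j _ => norm_nonneg _
  have haK : ∀ j, ‖a j‖ ≤ K := fun j =>
    Finset.single_le_sum (f := fun j => ‖a j‖) (fun _ _ => norm_nonneg _) (Finset.mem_univ j)
  obtain ⟨N₂, hN₂r, hN₂c⟩ := hfin.exists_card_le hT
  have hε₁ : 0 < ε / (2 * (K * N₂ + 1)) := by positivity
  obtain ⟨S, hS, v, s, hv0, hvS, hvs, hv1, hvT⟩ := hA.exists_kernel hε₁ hT
  set ε₁ := ε / (2 * (K * N₂ + 1)) with hε₁_def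
  obtain ⟨N, l, hl⟩ := hfin.exists_labelling hS
  set U : SetRel X X := S.inv.comp S with hU_def
  have hU : U ∈ C.controlled := C.comp_mem _ (C.inv_mem _ hS) _ hS
  obtain ⟨N₁, hN₁r, hN₁c⟩ := hfin.exists_card_le hU
  -- `ε₁` and `δ` are chosen so that `δ * N₁ + ε₁ * K * N₂ ≤ ε`. Here `S`, and with it `U` and `N₁`,
  -- depends on `ε₁`, so that `δ` is chosen last.
  set δ : ℝ := ε / (2 * (N₁ + 1)) with hδ_def
  have hδ : 0 < δ := by positivity
  have hcol : ∀ y (t : Finset X), ∑ x ∈ t, v x y ^ 2 ≤ 1 := by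
    intro y t
    calc ∑ x ∈ t, v x y ^ 2 ≤ ∑ x ∈ t ∪ s y, v x y ^ 2 :=
          Finset.sum_le_sum_of_subset_of_nonneg Finset.subset_union_left fun _ _ _ => sq_nonneg _
      _ = ∑ x ∈ s y, v x y ^ 2 := by
          refine (Finset.sum_subset Finset.subset_union_right fun x _ hx => ?_).symm
          have : v x y = 0 := by
            by_contra h0
            exact hx (hvs x y h0)
          simp [this]
      _ = 1 := hv1 y
  have hvv0 : ∀ x y z, 0 ≤ v x y * v x z := fun x y z => mul_nonneg (hv0 x y) (hv0 x z)
  have hvv : ∀ y z, ∑ x ∈ s y, v x y * v x z ≤ 1 := by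
    intro y z
    calc ∑ x ∈ s y, v x y * v x z ≤ ∑ x ∈ s y, (v x y ^ 2 + v x z ^ 2) / 2 :=
          Finset.sum_le_sum fun x _ => by nlinarith [sq_nonneg (v x y - v x z)]
      _ ≤ 1 := by
          rw [← Finset.sum_div, Finset.sum_add_distrib]
          have h1 := hcol y (s y)
          have h2 := hcol z (s y)
          linarith
  -- `e x p` is `δ_y` for the point `y` of the row `S_x` with label `p`, and `0` if there is none.
  let e : X → Fin N → EllTwo X := fun x p =>
    if h : ∃ y, (x, y) ∈ S ∧ l x y = p then EllTwo.delta h.choose else 0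
  have he : ∀ x y, (x, y) ∈ S → e x (l x y) = EllTwo.delta y := by
    intro x y hxy
    have h : ∃ y', (x, y') ∈ S ∧ l x y' = l x y := ⟨y, hxy, rfl⟩
    simp only [e, dif_pos h]
    rw [hl x _ y h.choose_spec.1 hxy h.choose_spec.2]
  have he_norm : ∀ x p, ‖e x p‖ ≤ 1 := by
    intro x p
    by_cases h : ∃ y, (x, y) ∈ S ∧ l x y = p
    · simp only [e, dif_pos h, EllTwo.norm_delta, le_refl]
    · simp only [e, dif_neg h, norm_zero, zero_le_one]
  have he_orth : ∀ x p q, p ≠ q → ⟪e x p, e x q⟫_ℂ = 0 := by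
    intro x p q hpq
    by_cases hp : ∃ y, (x, y) ∈ S ∧ l x y = p
    · by_cases hq : ∃ y, (x, y) ∈ S ∧ l x y = q
      · obtain ⟨y, hy, rfl⟩ := hp
        obtain ⟨z, hz, rfl⟩ := hq
        rw [he x y hy, he x z hz, EllTwo.inner_delta_delta, if_neg]
        rintro rfl
        exact hpq rfl
      · simp only [e, dif_neg hq, inner_zero_right]
    · simp only [e, dif_neg hp, inner_zero_left]
  -- `f x j` is the compression of `a j` to the block `S_x`; it is approximated, uniformly in `x`,
  -- by its values on a finite set `t`.
  let f : X → J → Fin N → Fin N → ℂ := fun x j p q => ⟪e x p, a j (e x q)⟫_ℂ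
  have hf : Bornology.IsBounded (Set.range f) := by
    refine (Metric.isBounded_closedBall (x := (0 : J → Fin N → Fin N → ℂ)) (r := K)).subset ?_
    rintro _ ⟨x, rfl⟩
    rw [mem_closedBall_zero_iff]
    refine (pi_norm_le_iff_of_nonneg hK0).mpr fun j => (pi_norm_le_iff_of_nonneg hK0).mpr fun p =>
      (pi_norm_le_iff_of_nonneg hK0).mpr fun q => ?_
    calc ‖⟪e x p, a j (e x q)⟫_ℂ‖ ≤ ‖e x p‖ * (‖a j‖ * ‖e x q‖) :=
          (norm_inner_le_norm _ _).trans (by gcongr; exact (a j).le_opNorm _)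
      _ ≤ 1 * (K * 1) := by
          gcongr
          · exact he_norm x p
          · exact haK j
          · exact he_norm x q
      _ = K := by ring
  obtain ⟨t, ht⟩ := exists_finset_net f hf hδ
  choose g hgt hg using ht
  have hfg : ∀ x j p q, ‖f (g x) j p q - f x j p q‖ ≤ δ := by
    intro x j p q
    rw [← dist_eq_norm, dist_comm]
    exact (((dist_le_pi_dist _ _ q).trans (dist_le_pi_dist _ _ p)).trans
      (dist_le_pi_dist _ _ j)).trans (hg x).le
  let g' : X → t := fun x => ⟨g x, hgt x⟩
  -- The rows of `c P` have at most one nonzero entry because labels are injective on `S_x`.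
  have hop : ∀ P : t × Fin N, ∃ c : EllTwo X →L[ℂ] EllTwo X, ∀ x y, EllTwo.coeff c x y =
      if P = (g' x, l x y) then (v x y : ℂ) else 0 := by
    intro P
    refine EllTwo.exists_coeff_eq_of_row_subsingleton _ (fun x y z hy hz => ?_) fun y u => ?_
    · rw [ite_ne_right_iff] at hy hz
      refine hl x y z (hvS x y (by exact_mod_cast hy.2)) (hvS x z (by exact_mod_cast hz.2)) ?_
      exact (Prod.ext_iff.mp (hy.1.symm.trans hz.1)).2
    · refine le_trans (Finset.sum_le_sum fun x _ => ?_) (hcol y u)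
      split_ifs
      · rw [Complex.norm_real, Real.norm_eq_abs, sq_abs]
      · simpa using sq_nonneg (v x y)
  choose c hc using hop
  have hcmem : ∀ P, c P ∈ C.bandAlgebra := by
    intro P
    refine Set.mem_iUnion₂.mpr ⟨S, hS, fun x y hxy => ?_⟩
    have : v x y = 0 := by
      by_contra h0
      exact hxy (hvS x y h0)
    simp [hc, this]
  -- The vectors `w r` live on the block of `r`, which makes `φ` block diagonal.
  let w : t → t × Fin N → EllTwo X := fun r P => if P.1 = r then e r P.2 else 0
  have hw : ∀ τ : t × Fin N → ℂ, ∑ r, ‖∑ P, τ P • w r P‖ ^ 2 ≤ ∑ P, ‖τ P‖ ^ 2 := by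
    intro τ
    rw [Fintype.sum_prod_type]
    refine Finset.sum_le_sum fun r _ => ?_
    have h1 : ∑ P, τ P • w r P = ∑ p, τ (r, p) • e r p := by
      rw [Fintype.sum_prod_type, Finset.sum_eq_single r]
      · simp [w]
      · intro r' _ hr'
        simp [w, hr']
      · simp
    rw [h1]
    exact norm_sq_sum_smul_le_of_orthogonal _ (he_orth r) (he_norm r) fun p => τ (r, p)
  have hblock : ∀ j i p q, ∑ r, ⟪w r (i, p), a j (w r (i, q))⟫_ℂ = f i j p q := by
    intro j i p q
    rw [Finset.sum_eq_single i]
    · simp [w, f]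
    · intro r _ hr
      simp [w, hr.symm]
    · simp
  have hone : ‖∑ P, star (c P) * c P‖ ≤ 1 := by
    have h1 : ∑ P, star (c P) * c P =
        ∑ P, ∑ Q, (if P = Q then (1 : ℂ) else 0) • (star (c P) * c Q) := by
      simp [ite_smul]
    have h2 : ∀ y z, EllTwo.coeff (∑ P, star (c P) * c P) y z = if y = z then 1 else 0 := by
      intro y z
      rw [h1, EllTwo.coeff_sum_block hvs g' l c hc]
      by_cases hyz : y = z
      · subst hyz
        simp only [if_true, mul_one]
        have := hv1 y
        simp only [sq] at this
        exact_mod_cast this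
      · rw [if_neg hyz]
        refine Finset.sum_eq_zero fun x _ => ?_
        by_cases h0 : v x y = 0 ∨ v x z = 0
        · rcases h0 with h0 | h0 <;> simp [h0]
        · push Not at h0
          rw [if_neg, mul_zero]
          intro h
          exact hyz (hl x y z (hvS x y h0.1) (hvS x z h0.2) (Prod.ext_iff.mp h).2)
    refine EllTwo.norm_le_of_sum_norm_coeff_le _ zero_le_one (fun y u => ?_) fun z u => ?_
    · simp only [h2, apply_ite norm, norm_one, norm_zero, Finset.sum_ite_eq]
      split_ifs <;> norm_num
    · simp only [h2, apply_ite norm, norm_one, norm_zero, Finset.sum_ite_eq']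
      split_ifs <;> norm_num
  have hmain : ∀ j, ‖∑ P, ∑ Q, (∑ r, ⟪w r P, a j (w r Q)⟫_ℂ) • (star (c P) * c Q) - a j‖ ≤ ε := by
    intro j
    -- The first summand is the error of replacing `x` by `g x`, the second that of Schur
    -- multiplication by the kernel.
    have hentry : ∀ y z, ‖EllTwo.coeff (∑ P, ∑ Q, (∑ r, ⟪w r P, a j (w r Q)⟫_ℂ) •
        (star (c P) * c Q) - a j) y z‖ ≤
        δ * (if (y, z) ∈ U then 1 else 0) + ε₁ * K * (if (y, z) ∈ T then 1 else 0) := by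
      intro y z
      rw [EllTwo.coeff_sub, EllTwo.coeff_sum_block hvs g' l c hc]
      simp only [hblock]
      set α := EllTwo.coeff (a j) y z with hα
      have hsplit : ∑ x ∈ s y, (v x y * v x z : ℂ) * f (g' x) j (l x y) (l x z) - α =
          ∑ x ∈ s y, (v x y * v x z : ℂ) * (f (g x) j (l x y) (l x z) - α) +
            ((∑ x ∈ s y, v x y * v x z - 1 : ℝ) : ℂ) * α := by
        push_cast
        simp only [mul_sub, Finset.sum_sub_distrib, ← Finset.sum_mul, sub_mul, one_mul]
        ring
      rw [hsplit]
      refine (norm_add_le _ _).trans (add_le_add ?_ ?_)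
      · have hle : ‖∑ x ∈ s y, (v x y * v x z : ℂ) * (f (g x) j (l x y) (l x z) - α)‖ ≤
            δ * ∑ x ∈ s y, v x y * v x z := by
          rw [Finset.mul_sum]
          refine (norm_sum_le _ _).trans (Finset.sum_le_sum fun x _ => ?_)
          by_cases h0 : v x y = 0 ∨ v x z = 0
          · rcases h0 with h0 | h0 <;> simp [h0]
          · push Not at h0
            have hαf : α = f x j (l x y) (l x z) := by
              simp only [hα, f, he x y (hvS x y h0.1), he x z (hvS x z h0.2), EllTwo.coeff]
            rw [norm_mul, hαf, ← Complex.ofReal_mul, Complex.norm_real,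
              Real.norm_of_nonneg (hvv0 x y z), mul_comm]
            exact mul_le_mul_of_nonneg_right (hfg x j _ _) (hvv0 x y z)
        refine hle.trans (mul_le_mul_of_nonneg_left ?_ hδ.le)
        split_ifs with hyz
        · exact hvv y z
        · refine (Finset.sum_eq_zero fun x _ => ?_).le
          by_contra h0
          exact hyz ⟨x, hvS x y (left_ne_zero_of_mul h0), hvS x z (right_ne_zero_of_mul h0)⟩
      · rw [norm_mul, Complex.norm_real]
        split_ifs with hyz
        · rw [mul_one]
          refine mul_le_mul ?_ ((EllTwo.norm_coeff_le _ _ _).trans (haK j)) (norm_nonneg _) hε₁.le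
          rw [Real.norm_eq_abs, abs_le]
          constructor
          · linarith [hvT y z hyz]
          · linarith [hvv y z]
        · rw [hα, ha j y z hyz, norm_zero, mul_zero, mul_zero]
    have hbound : δ * N₁ + ε₁ * K * N₂ ≤ ε := by
      have h1 : δ * N₁ ≤ ε / 2 := by
        rw [hδ_def, div_mul_eq_mul_div, div_le_div_iff₀ (by positivity) two_pos]
        nlinarith
      have h2 : ε₁ * K * N₂ ≤ ε / 2 := by
        rw [hε₁_def, mul_assoc, div_mul_eq_mul_div, div_le_div_iff₀ (by positivity) two_pos]
        nlinarith
      linarith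
    refine EllTwo.norm_le_of_sum_norm_coeff_le _ hε.le (fun y u => ?_) fun z u => ?_
    · refine (Finset.sum_le_sum fun z _ => hentry y z).trans (le_trans ?_ hbound)
      rw [Finset.sum_add_distrib, ← Finset.mul_sum, ← Finset.mul_sum, Finset.sum_boole,
        Finset.sum_boole]
      gcongr
      · exact hN₁r y _ fun z hz => (Finset.mem_filter.mp hz).2
      · exact hN₂r y _ fun z hz => (Finset.mem_filter.mp hz).2
    · refine (Finset.sum_le_sum fun y _ => hentry y z).trans (le_trans ?_ hbound)
      rw [Finset.sum_add_distrib, ← Finset.mul_sum, ← Finset.mul_sum, Finset.sum_boole,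
        Finset.sum_boole]
      gcongr
      · exact hN₁c z _ fun y hy => (Finset.mem_filter.mp hy).2
      · exact hN₂c z _ fun y hy => (Finset.mem_filter.mp hy).2
  let en := (Fintype.equivFin (t × Fin N)).symm
  let er := (Fintype.equivFin t).symm
  refine ⟨_, _, fun p => c (en p), fun r p => w (er r) (en p), fun p => hcmem _, ?_, fun τ => ?_,
    fun j => ?_⟩
  · rwa [Equiv.sum_comp en fun P => star (c P) * c P]
  · have h := hw (τ ∘ en.symm)
    rw [← Equiv.sum_comp er, ← Equiv.sum_comp en] at h
    simp only [← Equiv.sum_comp en, Function.comp_apply, Equiv.symm_apply_apply] at h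
    exact h
  · have h := hmain j
    simp only [← Equiv.sum_comp er, ← Equiv.sum_comp en] at h
    exact h

/-- Finitely many elements of the uniform Roe algebra are approximated by operators in one common
space `E_T`. -/
theorem exists_bandSpace_approx (F : Finset C.uniformRoeAlgebra) {ε : ℝ} (hε : 0 < ε) :
    ∃ T ∈ C.controlled, ∀ a ∈ F, ∃ b : EllTwo X →L[ℂ] EllTwo X, b ∈ bandSpace T ∧
      ‖(a : EllTwo X →L[ℂ] EllTwo X) - b‖ < ε := by
  classical
  induction F using Finset.induction_on with
  | empty => exact ⟨_, C.id_mem, by simp⟩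
  | insert a F _ ih =>
    obtain ⟨T, hT, h⟩ := ih
    have ha : (a : EllTwo X →L[ℂ] EllTwo X) ∈ closure (⋃ T ∈ C.controlled, bandSpace T) := a.2
    obtain ⟨b, hb, hab⟩ := Metric.mem_closure_iff.mp ha ε hε
    obtain ⟨T', hT', hb⟩ := Set.mem_iUnion₂.mp hb
    refine ⟨T ∪ T', C.union_mem _ hT _ hT', fun x hx => ?_⟩
    rcases Finset.mem_insert.mp hx with rfl | hx
    · exact ⟨b, fun y z hyz => hb y z fun h => hyz (Or.inr h), by rwa [← dist_eq_norm]⟩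
    · obtain ⟨b, hb, h⟩ := h x hx
      exact ⟨b, fun y z hyz => hb y z fun h => hyz (Or.inl h), h⟩

end CoarseStructure

theorem mainTheorem3 {X : Type*} (C : CoarseStructure X)
    (hfin : C.UniformlyLocallyFinite) (hA : C.PropertyA) :
    IsNuclearCStarAlgebra C.uniformRoeAlgebra := by
  refine isNuclearCStarAlgebra_of_exists_tuple (H := EllTwo X)
    ((C.uniformRoeAlgebra.subtype : C.uniformRoeAlgebra →⋆ₐ[ℂ] (EllTwo X →L[ℂ] EllTwo X)) :
      C.uniformRoeAlgebra →⋆ₙₐ[ℂ] (EllTwo X →L[ℂ] EllTwo X)) ?_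
  intro F ε hε
  obtain ⟨T, hT, h⟩ := C.exists_bandSpace_approx F hε
  choose b hbT hb using h
  obtain ⟨n, m, c, w, hc, hc1, hw, happ⟩ := CoarseStructure.exists_tuple_of_mem_bandSpace hfin hA hT
    (fun j : F => b j.1 j.2) (fun j => hbT j.1 j.2) hε
  have hband : ∀ x ∈ C.bandAlgebra, x ∈ C.uniformRoeAlgebra := fun x hx => subset_closure hx
  refine ⟨n, Fin m, inferInstance, fun p => ⟨c p, hband _ (hc p)⟩, w, ?_, hw, fun a ha => ?_⟩
  · refine le_of_eq_of_le ?_ hc1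
    change ‖C.uniformRoeAlgebra.subtype _‖ = _
    simp only [map_sum, map_mul, map_star]
    rfl
  · refine ⟨⟨b a ha, hband _ (Set.mem_iUnion₂.mpr ⟨T, hT, hbT a ha⟩)⟩, hb a ha, ?_⟩
    refine le_of_eq_of_le ?_ (happ ⟨a, ha⟩)
    change ‖C.uniformRoeAlgebra.subtype _‖ = _
    simp only [map_sub, map_sum, map_smul, map_mul, map_star]
    rfl
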